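/- Let $q$ be an odd prime power, let $\ell=2k+1>1$ be an odd integer, and define on the finite field $\mathbb F_{q^{2\ell}}$ the multiplication of the $P(q,\ell)$ (or LMPTB) semifield $$x*y=\tfrac12\bigl(xy+x^{q^\ell}y^{q^\ell}\bigr)+\tfrac14\,G\bigl(xy^{q^2}+x^{q^2}y\bigr),$$ $$G(x)=\sum_{i=0}^{k}(-1)^i\bigl(x-x^{q^\ell}\bigr)^{q^{2i}}+\sum_{j=0}^{k-1}(-1)^{k+j}\bigl(x-x^{q^\ell}\bigr)^{q^{2j+1}}.$$ Then $S=(\mathbb F_{q^{2\ell}},+,*)$ is a finite semifield, that is, it satisfies all axioms of a skewfield except possibly associativity of the multiplication. Its middle nucleus $\{b\in S: (a*b)*c=a*(b*c)\ \forall a,c\in S\}$ has order $q^2$. Its right nucleus $\{c\in S: (a*b)*c=a*(b*c)\ \forall a,b\in S\}$, its left nucleus $\{a\in S: (a*b)*c=a*(b*c)\ \forall b,c\in S\}$ and its center (the set of elements of all three nuclei that commute, with respect to $*$, with every element of $S$) all have order $q$. -/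

import Mathlib

namespace LMPTB

section Nuclei

variable {S : Type*} (mul : S → S → S)

/-- `(S, +, mul)` is a finite (possibly nonassociative) semifield: all axioms of a skewfield
except possibly associativity of the multiplication. For a finite structure, solvability of the
equations `mul a x = b` and `mul y a = b` with `a ≠ 0` is the absence of zero divisors. -/
structure IsFiniteSemifield [AddCommGroup S] : Prop where
  finite : Finite S
  left_distrib : ∀ a b c : S, mul a (b + c) = mul a b + mul a c
  right_distrib : ∀ a b c : S, mul (a + b) c = mul a c + mul b c
  exists_one : ∃ e : S, e ≠ 0 ∧ ∀ a : S, mul e a = a ∧ mul a e = a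
  no_zero_divisors : ∀ a b : S, mul a b = 0 → a = 0 ∨ b = 0

/-- The left nucleus. -/
def leftNucleus : Set S := {a | ∀ b c : S, mul (mul a b) c = mul a (mul b c)}

/-- The middle nucleus. -/
def middleNucleus : Set S := {b | ∀ a c : S, mul (mul a b) c = mul a (mul b c)}

/-- The right nucleus. -/
def rightNucleus : Set S := {c | ∀ a b : S, mul (mul a b) c = mul a (mul b c)}

/-- The center: the elements of all three nuclei that commute with every element. -/
def center : Set S :=
  {a | a ∈ leftNucleus mul ∩ middleNucleus mul ∩ rightNucleus mul ∧ ∀ b : S, mul a b = mul b a}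

end Nuclei

section Multiplication

variable {F : Type*} [Field F]

/-- The map `G(x) = ∑_{i=0}^{k} (-1)^i t^{q^{2i}} + ∑_{j=0}^{k-1} (-1)^{k+j} t^{q^{2j+1}}`,
where `t = x - x^{q^ℓ}` and `ℓ = 2k+1` (so that `k = ℓ / 2`, rounded down, for odd `ℓ`). -/
def G (q ℓ : ℕ) (x : F) : F :=
  ∑ i ∈ Finset.range (ℓ / 2 + 1), (-1) ^ i * (x - x ^ q ^ ℓ) ^ q ^ (2 * i) +
    ∑ j ∈ Finset.range (ℓ / 2), (-1) ^ (ℓ / 2 + j) * (x - x ^ q ^ ℓ) ^ q ^ (2 * j + 1)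

/-- The multiplication of the `P(q, ℓ)` semifield on the field of order `q^{2ℓ}`:
`x * y = (x y + x^{q^ℓ} y^{q^ℓ}) / 2 + G(x y^{q^2} + x^{q^2} y) / 4`. -/
def mulP (q ℓ : ℕ) (x y : F) : F :=
  (1 / 2) * (x * y + x ^ q ^ ℓ * y ^ q ^ ℓ) + (1 / 4) * G q ℓ (x * y ^ q ^ 2 + x ^ q ^ 2 * y)

end Multiplication

end LMPTB

/-! Let `τ` and `ρ` be the maps `x ↦ x ^ q ^ ℓ` and `x ↦ x ^ q ^ 2`. Since `G` telescopes under `1 +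
ρ`, the product is determined by two equations free of `G`, one for its `τ`-symmetric and one for
its antisymmetric part. They suffice because 2 is invertible and `ρ ^ ℓ = 1` with `ℓ` odd makes `1 +
ρ` injective.

Products with a `ρ`-fixed factor are ordinary, so the fixed field of `ρ`, of order `q ^ 2`, lies in
the middle nucleus. Associativity tested on a `ρ`-fixed, `τ`-antisymmetric `ε` and a `τ`-fixed `a`
moved by `ρ` excludes everything else. By commutativity the other nuclei and the center coincide;
they are the common fixed field of `ρ` and `τ`, of order `q` as `ℓ` is odd. -/

namespace LMPTB

/-! ### Multiplications given by their symmetric and antisymmetric parts -/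

section SplitMul

variable {F : Type*} [Field F]

/-- `IsSplitMul τ ρ m` says that `m x y` is the element whose `τ`-symmetric part is that of `x y`
and whose `τ`-antisymmetric part has under `1 + ρ` the antisymmetric part of
`x ρ(y) + ρ(x) y` as its image. -/
structure IsSplitMul (τ ρ : F →+* F) (m : F → F → F) : Prop where
  comm : ∀ x, τ (ρ x) = ρ (τ x)
  invol : ∀ x, τ (τ x) = x
  eq_zero_of_map_eq_neg : ∀ u, ρ u = -u → u = 0
  two_ne_zero : (2 : F) ≠ 0
  mul_add : ∀ x y, m x y + τ (m x y) = x * y + τ (x * y)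
  mul_sub : ∀ x y, m x y - τ (m x y) + ρ (m x y - τ (m x y)) =
    x * ρ y + ρ x * y - τ (x * ρ y + ρ x * y)

namespace IsSplitMul

variable {τ ρ : F →+* F} {m : F → F → F}

theorem eq_of_add_map_eq (h : IsSplitMul τ ρ m) {u v : F} (huv : u + ρ u = v + ρ v) : u = v :=
  sub_eq_zero.mp <| h.eq_zero_of_map_eq_neg _ <| by
    rw [map_sub]; linear_combination huv

theorem eq_of_parts (h : IsSplitMul τ ρ m) {p r : F} (hadd : p + τ p = r + τ r)
    (hsub : p - τ p + ρ (p - τ p) = r - τ r + ρ (r - τ r)) : p = r := by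
  have hd := h.eq_of_add_map_eq hsub
  exact mul_left_cancel₀ h.two_ne_zero (by linear_combination hadd + hd)

theorem mul_comm (h : IsSplitMul τ ρ m) (x y : F) : m x y = m y x := by
  apply h.eq_of_parts
  · rw [h.mul_add, h.mul_add, _root_.mul_comm]
  · rw [h.mul_sub, h.mul_sub]
    simp only [map_add, map_mul]
    ring

theorem left_distrib (h : IsSplitMul τ ρ m) (x y z : F) : m x (y + z) = m x y + m x z := by
  apply h.eq_of_parts
  · have h1 := h.mul_add x y
    have h2 := h.mul_add x z
    rw [h.mul_add]
    simp only [map_add, map_mul] at *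
    linear_combination -h1 - h2
  · have h1 := h.mul_sub x y
    have h2 := h.mul_sub x z
    rw [h.mul_sub]
    simp only [map_add, map_sub, map_mul] at *
    linear_combination -h1 - h2

theorem mul_of_fixed (h : IsSplitMul τ ρ m) {y : F} (hy : ρ y = y) (x : F) :
    m x y = x * y := by
  apply h.eq_of_parts
  · exact h.mul_add x y
  · rw [h.mul_sub]
    simp only [map_add, map_sub, map_mul, h.comm, hy, ← h.comm y]
    ring

theorem mul_fixed_mul (h : IsSplitMul τ ρ m) {y : F} (hy : ρ y = y) (x z : F) :
    m (x * y) z = m x (y * z) := by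
  apply h.eq_of_parts
  · rw [h.mul_add, h.mul_add, mul_assoc]
  · rw [h.mul_sub, h.mul_sub]
    simp only [map_add, map_mul, hy]
    ring

theorem mul_mul_of_fixed (h : IsSplitMul τ ρ m) {c : F} (hc : ρ c = c) (hc' : τ c = c) (x y : F) :
    m x (y * c) = m x y * c := by
  apply h.eq_of_parts
  · have h1 := h.mul_add x y
    rw [h.mul_add]
    simp only [map_mul, hc'] at *
    linear_combination -c * h1
  · have h1 := h.mul_sub x y
    rw [h.mul_sub]
    simp only [map_add, map_sub, map_mul, hc, hc'] at *
    linear_combination -c * h1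

/-- If both factors were nonzero, the symmetric part would force `τ x = s * x` and `s * τ y = -y`.
The antisymmetric part then gives `ρ u = -u` for `u = τ x / y`, contradicting injectivity of `1 +
ρ`. -/
theorem eq_zero_or_eq_zero (h : IsSplitMul τ ρ m) {x y : F} (hxy : m x y = 0) :
    x = 0 ∨ y = 0 := by
  by_contra! hne
  obtain ⟨hx, hy⟩ := hne
  have hadd := h.mul_add x y
  have hsub := h.mul_sub x y
  have hx' : τ x ≠ 0 := (map_ne_zero τ).mpr hx
  have hy' : ρ y ≠ 0 := (map_ne_zero ρ).mpr hy
  have hu : τ x / y ≠ 0 := div_ne_zero hx' hy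
  simp only [hxy, map_add, map_mul, map_zero, add_zero, sub_zero] at hadd hsub
  obtain ⟨s, hs⟩ : ∃ s, τ x = s * x := ⟨τ x / x, by field_simp⟩
  have hs0 : s ≠ 0 := fun h0 => hx' (by simp [hs, h0])
  have hty : s * τ y = -y := mul_left_cancel₀ hx (by rw [hs] at hadd; linear_combination -hadd)
  have hty' : ρ s * ρ (τ y) = -ρ y := by rw [← map_mul, hty, map_neg]
  have hρs : ρ (τ x) = ρ s * ρ x := by rw [hs, map_mul]
  have hsum : s + ρ s ≠ 0 := fun h0 => hs0 (h.eq_zero_of_map_eq_neg s (by linear_combination h0))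
  rw [h.comm, h.comm, hρs, hs] at hsub
  have key : (s + ρ s) * (s * x * ρ y + ρ s * ρ x * y) = 0 := by
    linear_combination (-s * ρ s) * hsub + s ^ 2 * x * hty' + (ρ s) ^ 2 * ρ x * hty
  have key' := (mul_eq_zero.mp key).resolve_left hsum
  refine hu (h.eq_zero_of_map_eq_neg _ ?_)
  rw [map_div₀, hρs, hs]
  field_simp
  linear_combination key'

theorem isFiniteSemifield [Finite F] (h : IsSplitMul τ ρ m) : IsFiniteSemifield m where
  finite := ‹_›
  left_distrib := h.left_distrib
  right_distrib a b c := by simp only [h.mul_comm _ c, h.left_distrib]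
  exists_one := ⟨1, one_ne_zero, fun a => by
    rw [h.mul_comm 1, h.mul_of_fixed (map_one ρ), mul_one]; exact ⟨rfl, rfl⟩⟩
  no_zero_divisors _ _ := h.eq_zero_or_eq_zero

/-- Multiplication by `ε` swaps symmetric and antisymmetric parts. Comparing the parts of `y * a`
and `(y * ε) * a` leaves the nonzero factor `ρ a - a`, so `ρ` fixes both `y - τ y` and `y + τ y`. -/
theorem map_eq_of_mem_middleNucleus (h : IsSplitMul τ ρ m) {ε a y : F} (hε : ε ≠ 0)
    (hρε : ρ ε = ε) (hτε : τ ε = -ε) (hτa : τ a = a) (hρa : ρ a ≠ a)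
    (hy : y ∈ middleNucleus m) : ρ y = y := by
  have heq := hy ε a
  rw [h.mul_comm ε y, h.mul_of_fixed hρε, h.mul_comm ε, h.mul_of_fixed hρε] at heq
  have hadd := h.mul_add y a
  have hsub := h.mul_sub y a
  have hadd' := h.mul_add (y * ε) a
  have hsub' := h.mul_sub (y * ε) a
  rw [heq] at hadd' hsub'
  simp only [map_add, map_sub, map_mul, h.comm, hρε, hτε, hτa, map_neg] at hadd hsub hadd' hsub'
  have hτy : ρ (y - τ y) = y - τ y := by
    have hD : m y a - τ (m y a) = (y - τ y) * a :=
      mul_right_cancel₀ hε (by linear_combination hadd')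
    have hD' := congrArg ρ hD
    rw [← sub_eq_zero]
    refine (mul_eq_zero.mp (?_ : (ρ a - a) * _ = 0)).resolve_left (sub_ne_zero.mpr hρa)
    simp only [map_sub, map_mul] at hD' ⊢
    linear_combination hsub - hD - hD'
  have hτy' : ρ (y + τ y) = y + τ y := by
    have hC := congrArg ρ hadd
    rw [← sub_eq_zero]
    refine (mul_eq_zero.mp (?_ : (ε * (ρ a - a)) * _ = 0)).resolve_left
      (mul_ne_zero hε (sub_ne_zero.mpr hρa))
    simp only [map_add, map_mul] at hC ⊢
    linear_combination hsub' - ε * hadd - ε * hC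
  rw [map_sub] at hτy
  rw [map_add] at hτy'
  exact mul_left_cancel₀ h.two_ne_zero (by linear_combination hτy + hτy')

theorem middleNucleus_eq (h : IsSplitMul τ ρ m) {ε a : F} (hε : ε ≠ 0)
    (hρε : ρ ε = ε) (hτε : τ ε = -ε) (hτa : τ a = a) (hρa : ρ a ≠ a) :
    middleNucleus m = {y | ρ y = y} := by
  ext y
  refine ⟨h.map_eq_of_mem_middleNucleus hε hρε hτε hτa hρa, fun hy x z => ?_⟩
  rw [h.mul_of_fixed hy, h.mul_comm y, h.mul_of_fixed hy, h.mul_fixed_mul hy, _root_.mul_comm]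

theorem leftNucleus_eq_rightNucleus (h : IsSplitMul τ ρ m) : leftNucleus m = rightNucleus m := by
  ext y
  constructor
  · intro hy a b
    rw [h.mul_comm _ y, h.mul_comm a b, ← hy b a, h.mul_comm b y, h.mul_comm _ a]
  · intro hy a b
    rw [h.mul_comm (m y a) b, h.mul_comm y a, ← hy b a, h.mul_comm b a, h.mul_comm _ y]

theorem leftNucleus_subset_middleNucleus (h : IsSplitMul τ ρ m) :
    leftNucleus m ⊆ middleNucleus m := by
  intro y hy a b
  rw [h.mul_comm a y, hy a b, h.mul_comm a b, ← hy b a, h.mul_comm _ a]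

theorem center_eq_leftNucleus (h : IsSplitMul τ ρ m) : center m = leftNucleus m := by
  ext y
  refine ⟨fun hy => hy.1.1.1, fun hy => ⟨⟨⟨hy, h.leftNucleus_subset_middleNucleus hy⟩, ?_⟩,
    h.mul_comm y⟩⟩
  rwa [← h.leftNucleus_eq_rightNucleus]

theorem rightNucleus_eq (h : IsSplitMul τ ρ m) {ε a : F} (hε : ε ≠ 0)
    (hρε : ρ ε = ε) (hτε : τ ε = -ε) (hτa : τ a = a) (hρa : ρ a ≠ a) :
    rightNucleus m = {y | ρ y = y ∧ τ y = y} := by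
  ext y
  constructor
  · intro hy
    rw [← h.leftNucleus_eq_rightNucleus] at hy
    have hρy := h.map_eq_of_mem_middleNucleus hε hρε hτε hτa hρa
      (h.leftNucleus_subset_middleNucleus hy)
    refine ⟨hρy, ?_⟩
    have hyaa := hy a a
    rw [h.mul_comm y a, h.mul_comm y, h.mul_of_fixed hρy, h.mul_of_fixed hρy] at hyaa
    have hadd := h.mul_add a a
    have hsub := h.mul_sub a a
    have hsub' := h.mul_sub (a * y) a
    rw [hyaa] at hsub'
    -- As `τ a = a`, the square of `a` is the ordinary one. The antisymmetric part of `(a * y) * a =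
    -- a ^ 2 * y` then reads `(ρ a - a) ^ 2 * (y - τ y) = 0`.
    have hfix : τ (m a a) = m a a := by
      rw [eq_comm, ← sub_eq_zero]
      refine h.eq_zero_of_map_eq_neg _ ?_
      simp only [map_add, map_sub, map_mul, h.comm, hτa] at hsub ⊢
      linear_combination hsub
    have hsq : m a a = a * a := by
      refine mul_left_cancel₀ h.two_ne_zero ?_
      rw [hfix, map_mul, hτa] at hadd
      linear_combination hadd
    have hρτy : ρ (τ y) = τ y := by rw [← h.comm, hρy]
    rw [hsq] at hsub'
    simp only [map_add, map_sub, map_mul, h.comm, hτa, hρy, hρτy] at hsub'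
    rw [eq_comm, ← sub_eq_zero]
    refine (mul_eq_zero.mp (?_ : (ρ a - a) ^ 2 * _ = 0)).resolve_left
      (pow_ne_zero 2 (sub_ne_zero.mpr hρa))
    linear_combination hsub'
  · rintro ⟨hρy, hτy⟩ x z
    rw [h.mul_of_fixed hρy, h.mul_of_fixed hρy, h.mul_mul_of_fixed hρy hτy]

end IsSplitMul

end SplitMul

end LMPTB

namespace LMPTB

/-! ### Frobenius powers, their fixed points, and the sum `G` -/

section Frobenius

variable {F : Type*} [Field F]

theorem iterate_eq_of_map_eq_neg {f : F →+* F} {n : ℕ} (hn : Odd n) {u : F}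
    (hu : f u = -u) : f^[n] u = -u := by
  obtain ⟨k, rfl⟩ := hn
  have h2 : f^[2] u = u := by simp [hu]
  rw [Function.iterate_add_apply, Function.iterate_one, hu, iterate_map_neg, Function.iterate_mul,
    Function.iterate_fixed h2]

/-- The solutions are 0 and the kernel of the `(N - 1)`-th power map on the cyclic group of units.
-/
theorem ncard_pow_eq_self [Finite F] {N : ℕ} (hN : 1 < N) (hdvd : N - 1 ∣ Nat.card F - 1) :
    {x : F | x ^ N = x}.ncard = N := by
  obtain ⟨n, rfl⟩ : ∃ n, N = n + 1 := ⟨N - 1, by omega⟩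
  have hn : n ≠ 0 := by omega
  have hset : {x : F | x ^ (n + 1) = x} =
      insert 0 (Units.val '' ((powMonoidHom n : Fˣ →* Fˣ).ker : Set Fˣ)) := by
    ext x
    rcases eq_or_ne x 0 with rfl | hx
    · simp
    · simp only [Set.mem_ofPred_eq, Set.mem_insert_iff, hx, false_or, Set.mem_image, SetLike.mem_coe,
        MonoidHom.mem_ker, powMonoidHom_apply]
      constructor
      · intro h
        refine ⟨Units.mk0 x hx, Units.ext ?_, rfl⟩
        exact mul_right_cancel₀ hx (by simpa [pow_succ] using h)
      · rintro ⟨u, hu, rfl⟩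
        rw [pow_succ, ← Units.val_pow_eq_pow_val, hu, Units.val_one, one_mul]
  have hcard : Nat.card (powMonoidHom n : Fˣ →* Fˣ).ker = n := by
    rw [IsCyclic.card_powMonoidHom_ker, Nat.card_units]
    exact Nat.gcd_eq_right (by simpa using hdvd)
  rw [hset, Set.ncard_insert_of_notMem (by simp) (Set.toFinite _),
    Set.ncard_image_of_injective _ Units.val_injective]
  exact congrArg (· + 1) hcard

variable {q ℓ : ℕ}

theorem ncard_pow_pow_eq_self [Finite F] {m n : ℕ} (hq : 1 < q) (hm : m ≠ 0)
    (hF : Nat.card F = q ^ n) (hmn : m ∣ n) : {x : F | x ^ q ^ m = x}.ncard = q ^ m :=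
  ncard_pow_eq_self (Nat.one_lt_pow hm hq) (hF ▸ Nat.pow_sub_one_dvd_pow_sub_one q hmn)

theorem pow_pow_iterate (x : F) (m n : ℕ) : (fun y : F => y ^ q ^ m)^[n] x = x ^ q ^ (m * n) := by
  induction n with
  | zero => simp
  | succ n ih =>
    rw [Function.iterate_succ_apply', ih, ← pow_mul, ← pow_add, Nat.mul_succ]

/-- `G` is the alternating sum over the first `ℓ` powers of `x ↦ x ^ q ^ 2`. -/
theorem G_eq_sum (hq_odd : Odd q) (hℓ_odd : Odd ℓ) {x t : F}
    (hx : x - x ^ q ^ ℓ = t) (ht : t ^ q ^ ℓ = -t) :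
    G q ℓ x = ∑ i ∈ Finset.range ℓ, (-1) ^ i * t ^ q ^ (2 * i) := by
  obtain ⟨k, rfl⟩ := hℓ_odd
  have hk : (2 * k + 1) / 2 = k := by omega
  rw [G, hx, hk, show 2 * k + 1 = k + 1 + k by omega, Finset.sum_range_add _ (k + 1) k]
  congr 1
  refine Finset.sum_congr rfl fun j _ => ?_
  -- The exponent passes `ℓ`, and raising to the power `q ^ ℓ` negates `t`: this is the source of
  -- the odd exponents in `G`.
  rw [show 2 * (k + 1 + j) = 2 * k + 1 + (2 * j + 1) by ring, pow_add q (2 * k + 1),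
    pow_mul t (q ^ (2 * k + 1)), ht, (hq_odd.pow).neg_pow]
  ring

theorem G_parts {τ ρ : F →+* F} (hτ : ∀ x, τ x = x ^ q ^ ℓ) (hρ : ∀ x, ρ x = x ^ q ^ 2)
    (hτρ : ∀ x, τ (τ x) = x) (hq_odd : Odd q) (hℓ_odd : Odd ℓ) (x : F) :
    τ (G q ℓ x) = -G q ℓ x ∧ G q ℓ x + ρ (G q ℓ x) = 2 * (x - τ x) := by
  set t := x - τ x with ht
  have hτt : τ t = -t := by rw [ht, map_sub, hτρ]; ring
  have hG := G_eq_sum hq_odd hℓ_odd (x := x) (t := t) (by rw [ht, hτ]) (by rw [← hτ, hτt])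
  rw [hG]
  constructor
  · rw [map_sum, ← Finset.sum_neg_distrib]
    refine Finset.sum_congr rfl fun i _ => ?_
    rw [map_mul, map_pow, map_pow, hτt, map_neg, map_one, (hq_odd.pow).neg_pow]
    ring
  · have hstep : ∀ i, (-1) ^ i * t ^ q ^ (2 * i) + ρ ((-1) ^ i * t ^ q ^ (2 * i)) =
        (-1) ^ i * t ^ q ^ (2 * i) - (-1) ^ (i + 1) * t ^ q ^ (2 * (i + 1)) := by
      intro i
      rw [map_mul, map_pow, map_neg, map_one, hρ, ← pow_mul, ← pow_add, Nat.mul_succ]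
      ring
    rw [map_sum, ← Finset.sum_add_distrib, Finset.sum_congr rfl fun i _ => hstep i,
      Finset.sum_range_sub']
    have hlast : t ^ q ^ (2 * ℓ) = t := by
      rw [two_mul, pow_add q, pow_mul, ← hτ, ← hτ, hτt, map_neg, hτt, neg_neg]
    rw [hlast, hℓ_odd.neg_one_pow]
    simp
    ring

theorem isSplitMul_mulP {τ ρ : F →+* F} (hτ : ∀ x, τ x = x ^ q ^ ℓ) (hρ : ∀ x, ρ x = x ^ q ^ 2)
    (hF : ∀ x : F, x ^ q ^ (2 * ℓ) = x) (h2 : (2 : F) ≠ 0) (hq_odd : Odd q) (hℓ_odd : Odd ℓ) :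
    IsSplitMul τ ρ (mulP q ℓ : F → F → F) := by
  have hinvol : ∀ x, τ (τ x) = x := fun x => by
    rw [hτ, hτ, ← pow_mul, ← pow_add, ← two_mul, hF]
  have hmul : ∀ x y, mulP q ℓ x y =
      1 / 2 * (x * y + τ (x * y)) + 1 / 4 * G q ℓ (x * ρ y + ρ x * y) := fun x y => by
    simp only [mulP, hτ, hρ, mul_pow]
  have h4 : (4 : F) ≠ 0 := by
    rw [show (4 : F) = 2 * 2 by norm_num]; exact mul_ne_zero h2 h2
  refine ⟨fun x => ?_, hinvol, fun u hu => ?_, h2, fun x y => ?_, fun x y => ?_⟩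
  · rw [hτ, hρ, hρ, hτ, ← pow_mul, ← pow_mul, mul_comm]
  · have h := iterate_eq_of_map_eq_neg hℓ_odd hu
    rw [show (ρ : F → F) = fun y => y ^ q ^ 2 from funext hρ, pow_pow_iterate, hF] at h
    exact (mul_eq_zero.mp (by linear_combination h : 2 * u = 0)).resolve_left h2
  · have hG := (G_parts hτ hρ hinvol hq_odd hℓ_odd (x * ρ y + ρ x * y)).1
    rw [hmul, map_add, map_mul τ (1 / 2), map_mul τ (1 / 4), hG]
    simp only [map_add, map_mul, map_div₀, map_one, map_ofNat, hinvol]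
    field_simp
    ring
  · obtain ⟨hG, hG'⟩ := G_parts hτ hρ hinvol hq_odd hℓ_odd (x * ρ y + ρ x * y)
    have hsub : mulP q ℓ x y - τ (mulP q ℓ x y) = 1 / 2 * G q ℓ (x * ρ y + ρ x * y) := by
      rw [hmul, map_add, map_mul τ (1 / 2), map_mul τ (1 / 4), hG]
      simp only [map_add, map_mul, map_div₀, map_one, map_ofNat, hinvol]
      field_simp
      ring
    rw [hsub, map_mul, map_div₀, map_one, map_ofNat, ← mul_add, hG', ← mul_assoc,
      one_div_mul_cancel h2, one_mul]

theorem exists_frobenius [Finite F] (hq : IsPrimePow q) {n : ℕ}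
    (hF : Nat.card F = q ^ n) (m : ℕ) : ∃ f : F →+* F, ∀ x, f x = x ^ q ^ m := by
  obtain ⟨p, k, hp, hk, rfl⟩ := hq
  have : Fintype F := Fintype.ofFinite F
  have hp0 : (p : F) = 0 := by
    have h := FiniteField.cast_card_eq_zero F
    rw [← Nat.card_eq_fintype_card, hF, Nat.cast_pow, Nat.cast_pow] at h
    exact eq_zero_of_pow_eq_zero (eq_zero_of_pow_eq_zero h)
  have : Fact p.Prime := ⟨hp.nat_prime⟩
  have : CharP F p := (CharP.charP_iff_prime_eq_zero hp.nat_prime).mpr hp0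
  exact ⟨iterateFrobenius F p (k * m), fun x => by rw [iterateFrobenius_def, pow_mul]⟩

end Frobenius

end LMPTB

theorem mainTheorem10 (q ℓ : ℕ) (hq : IsPrimePow q) (hq_odd : Odd q) (hℓ : 1 < ℓ)
    (hℓ_odd : Odd ℓ) (F : Type*) [Field F] [Finite F] (hF : Nat.card F = q ^ (2 * ℓ)) :
    LMPTB.IsFiniteSemifield (LMPTB.mulP q ℓ : F → F → F) ∧
    (LMPTB.middleNucleus (LMPTB.mulP q ℓ : F → F → F)).ncard = q ^ 2 ∧
    (LMPTB.rightNucleus (LMPTB.mulP q ℓ : F → F → F)).ncard = q ∧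
    (LMPTB.leftNucleus (LMPTB.mulP q ℓ : F → F → F)).ncard = q ∧
    (LMPTB.center (LMPTB.mulP q ℓ : F → F → F)).ncard = q := by
  have hq1 := hq.one_lt
  obtain ⟨σ, hσ⟩ := LMPTB.exists_frobenius hq hF 1
  obtain ⟨τ, hτ⟩ := LMPTB.exists_frobenius hq hF ℓ
  obtain ⟨ρ, hρ⟩ := LMPTB.exists_frobenius hq hF 2
  have hpow : ∀ x : F, x ^ q ^ (2 * ℓ) = x := fun x => by
    have := Fintype.ofFinite F
    rw [← hF, Nat.card_eq_fintype_card, FiniteField.pow_card]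
  have h2 : (2 : F) ≠ 0 := by
    have := Fintype.ofFinite F
    refine Ring.two_ne_zero fun h => ?_
    have := FiniteField.even_card_of_char_two h
    rw [← Nat.card_eq_fintype_card, hF] at this
    exact Nat.not_even_iff_odd.mpr hq_odd.pow (Nat.even_iff.mpr this)
  have h := LMPTB.isSplitMul_mulP hτ hρ hpow h2 hq_odd hℓ_odd
  have hρσ : ∀ x, ρ x = σ (σ x) := fun x => by rw [hρ, hσ, hσ, ← pow_mul, pow_one, sq]
  have hτσ : ∀ x, τ x = σ^[ℓ] x := fun x => by
    rw [show (σ : F → F) = fun y => y ^ q ^ 1 from funext hσ, LMPTB.pow_pow_iterate, one_mul, hτ]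
  have hcard1 : {x : F | σ x = x}.ncard = q := by
    simpa [hσ] using LMPTB.ncard_pow_pow_eq_self hq1 one_ne_zero hF (one_dvd _)
  have hcard2 : {x : F | ρ x = x}.ncard = q ^ 2 := by
    simpa only [hρ] using LMPTB.ncard_pow_pow_eq_self hq1 two_ne_zero hF (dvd_mul_right 2 ℓ)
  have hcardℓ : {x : F | τ x = x}.ncard = q ^ ℓ := by
    simpa only [hτ] using
      LMPTB.ncard_pow_pow_eq_self hq1 (by omega) hF (dvd_mul_left ℓ 2)
  have hfix : {x : F | ρ x = x ∧ τ x = x} = {x : F | σ x = x} := by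
    ext x
    refine ⟨fun ⟨hx, hx'⟩ => ?_, fun hx => ⟨?_, ?_⟩⟩
    · obtain ⟨k, rfl⟩ := hℓ_odd
      have hx2 : σ^[2] x = x := by simpa [hρσ] using hx
      rwa [hτσ, add_comm, Function.iterate_add_apply, Function.iterate_one, Function.iterate_mul,
        Function.iterate_fixed hx2] at hx'
    · rw [hρσ, Set.mem_ofPred_eq.mp hx, Set.mem_ofPred_eq.mp hx]
    · rw [hτσ]; exact Function.iterate_fixed hx ℓ
  obtain ⟨ε, hε, hρε, hτε⟩ : ∃ ε : F, ε ≠ 0 ∧ ρ ε = ε ∧ τ ε = -ε := by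
    -- For `x` fixed by `σ ^ 2` but not by `σ`, the difference `σ x - x` is negated by `σ`, hence by
    -- its odd power `τ`.
    obtain ⟨x, hx, hx'⟩ := Set.exists_mem_notMem_of_ncard_lt_ncard
      (s := {x : F | σ x = x}) (t := {x : F | ρ x = x}) (by
        rw [hcard1, hcard2]; exact lt_self_pow₀ hq1 one_lt_two)
    have hx2 : σ (σ x) = x := by rw [← hρσ]; exact hx
    have hσε : σ (σ x - x) = -(σ x - x) := by rw [map_sub, hx2, neg_sub]
    refine ⟨σ x - x, sub_ne_zero.mpr hx', ?_, ?_⟩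
    · rw [hρσ, hσε, map_neg, hσε, neg_neg]
    · rw [hτσ]; exact LMPTB.iterate_eq_of_map_eq_neg hℓ_odd hσε
  obtain ⟨a, hτa, hρa⟩ := Set.exists_mem_notMem_of_ncard_lt_ncard
    (s := {x : F | ρ x = x}) (t := {x : F | τ x = x}) (by
      rw [hcardℓ, hcard2]
      exact Nat.pow_lt_pow_right hq1 (by obtain ⟨k, rfl⟩ := hℓ_odd; omega))
  have hright : (LMPTB.rightNucleus (LMPTB.mulP q ℓ : F → F → F)).ncard = q := by
    rw [h.rightNucleus_eq hε hρε hτε hτa hρa, hfix, hcard1]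
  refine ⟨h.isFiniteSemifield, ?_, hright, ?_, ?_⟩
  · rw [h.middleNucleus_eq hε hρε hτε hτa hρa, hcard2]
  · rw [h.leftNucleus_eq_rightNucleus, hright]
  · rw [h.center_eq_leftNucleus, h.leftNucleus_eq_rightNucleus, hright]
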